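/- **Setting.** There are $n\ge 1$ buyers with valuations $\mathbf b=(b_1,\dots,b_n)$ and one seller with valuation $s$; $(\mathbf b,s)\sim\mathcal P$, a probability distribution supported on $[0,1]^{n+1}$. Let $\overline b$ be the highest and $\underline b$ the second-highest buyer valuation (the highest one among the buyers other than a buyer with valuation $\overline b$, ties broken arbitrarily; $\underline b=0$ if $n=1$). For prices $(p,q)\in[0,1]^2$ let $$\mathsf{GFT}(p,q)=\mathbb E_{\mathcal P}\big[(\overline b-s)\,\mathbb I(s\le p)\,\mathbb I(\overline b\ge q)\big],\qquad \mathsf{Rev}(p,q)=\mathbb E_{\mathcal P}\big[(\max\{q,\underline b\}-p)\,\mathbb I(s\le p)\,\mathbb I(\overline b\ge q)\big],$$ and let $(p^*,q^*)$ be any maximizer of $\mathsf{GFT}$ over the pairs $(p,q)\in[0,1]^2$ with $\mathsf{Rev}(p,q)\ge 0$. **Grid.** Let $T_0,K\ge 1$ be integers and $\delta\in(0,1)$. Draw $T_0$ i.i.d. samples from $\mathcal P$ and let $\mathcal O$ be the multiset of the $T_0$ observed values of $\overline b$. Put $p_0=0$, and for $0\le k<K$ let $p_{k+1}$ be the largest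 $q\in\mathcal O$ such that at most $T_0/K$ elements of $\mathcal O$ (with multiplicity) lie in the open interval $(p_k,q)$, and $p_{k+1}=1$ if there is no such $q$. Let $\mathcal B^S=\{i/K: 0\le i\le K\}$ and $\mathcal B^B=\{p_0,\dots,p_K\}\cup\{i/K:0\le i\le K\}$. Let $p_{k^*}$ be the smallest element of $\mathcal B^S$ with $p_{k^*}\ge p^*$ and $q_{j^*}$ the smallest element of $\mathcal B^B$ with $q_{j^*}\ge q^*$, and put $\zeta=-\mathsf{Rev}(p_{k^*},q_{j^*})$. **Lemma.** 1. Suppose that the buyers' valuations and the seller's valuation are independent, $\mathcal P=\mathcal P^B\times\mathcal P^S$, and that $\mathbb P(s\le p^*)>0$ or $p^*\in\mathcal B^S$. Then with probability at least $1-\delta$ over the samples, $$\zeta\le\frac2K+2\sqrt{\frac{\ln(2/\delta)}{2T_0}}.$$ 2. If $\mathcal P$ has a density with respect to Lebesgue measure that is bounded by $M$, then with probability at least $1-\delta$ over the samples, $\zeta\le 2M/K$. -/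

import Mathlib

open MeasureTheory ProbabilityTheory

namespace TwoSidedMarket

noncomputable section

/-- A valuation profile `(b, s)`: the valuations `b` of the `n` buyers and the valuation `s` of
the seller. -/
abbrev Valuations (n : ℕ) : Type := (Fin n → ℝ) × ℝ

/-- The highest buyer valuation. -/
def highest {n : ℕ} (b : Fin n → ℝ) : ℝ := ⨆ i, b i

/-- A buyer with the highest valuation, ties being broken arbitrarily. -/
def winner {n : ℕ} [NeZero n] (b : Fin n → ℝ) : Fin n := (Finite.exists_max b).choose

/-- The second-highest buyer valuation: the highest valuation among the buyers other than the
winner (it does not depend on how ties are broken; it is `0` if there is only one buyer). -/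
def secondHighest {n : ℕ} [NeZero n] (b : Fin n → ℝ) : ℝ := ⨆ i : {i // i ≠ winner b}, b i

/-- The trade takes place: the seller accepts `p` and the highest buyer valuation meets the
reserve price `q`. -/
def tradeSet {n : ℕ} (p q : ℝ) : Set (Valuations n) := {v | v.2 ≤ p ∧ q ≤ highest v.1}

/-- Expected gain from trade of the fixed prices `(p, q)`. -/
def GFT {n : ℕ} (P : Measure (Valuations n)) (p q : ℝ) : ℝ :=
  ∫ v, (tradeSet p q).indicator (fun v => highest v.1 - v.2) v ∂P

/-- Expected revenue of the fixed prices `(p, q)`. -/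
def Rev {n : ℕ} [NeZero n] (P : Measure (Valuations n)) (p q : ℝ) : ℝ :=
  ∫ v, (tradeSet p q).indicator (fun v => max q (secondHighest v.1) - p) v ∂P

/-- `P` is concentrated on `[0,1]^(n+1)`. -/
def SupportedOnCube {n : ℕ} (P : Measure (Valuations n)) : Prop :=
  ∀ᵐ v ∂P, (∀ i, v.1 i ∈ Set.Icc (0 : ℝ) 1) ∧ v.2 ∈ Set.Icc (0 : ℝ) 1

/-- The buyers' valuations (jointly) are independent of the seller's valuation. -/
def IsIndependent {n : ℕ} (P : Measure (Valuations n)) : Prop :=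
  ∃ (PB : Measure (Fin n → ℝ)) (PS : Measure ℝ),
    IsProbabilityMeasure PB ∧ IsProbabilityMeasure PS ∧ P = PB.prod PS

/-- `P` has a density with respect to the Lebesgue measure, and it is bounded by `M`. -/
def HasDensityBoundedBy {n : ℕ} (P : Measure (Valuations n)) (M : ℝ) : Prop :=
  ∃ f : Valuations n → ENNReal, Measurable f ∧ P = volume.withDensity f ∧
    ∀ᵐ v ∂(volume : Measure (Valuations n)), f v ≤ ENNReal.ofReal M

/-- `(p, q)` maximizes the gain from trade over the pairs of prices in `[0,1]²` with non-negative
revenue. -/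
structure IsOptimalPair {n : ℕ} [NeZero n] (P : Measure (Valuations n)) (p q : ℝ) : Prop where
  seller_mem : p ∈ Set.Icc (0 : ℝ) 1
  buyer_mem : q ∈ Set.Icc (0 : ℝ) 1
  rev_nonneg : 0 ≤ Rev P p q
  gft_le : ∀ p' ∈ Set.Icc (0 : ℝ) 1, ∀ q' ∈ Set.Icc (0 : ℝ) 1,
    0 ≤ Rev P p' q' → GFT P p' q' ≤ GFT P p q

/-- The multiset of the highest buyer valuations observed in `T₀` rounds with reserve price `0`. -/
def observed {n T₀ : ℕ} (x : Fin T₀ → Valuations n) : Multiset ℝ :=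
  Finset.univ.val.map fun t => highest (x t).1

/-- The observations `q` in `B` such that at most `T₀ / K` observations lie strictly between `p`
and `q`. -/
def candidates (T₀ K : ℕ) (B : Multiset ℝ) (p : ℝ) : Finset ℝ :=
  B.toFinset.filter fun q => ((B.filter fun b => p < b ∧ b < q).card : ℝ) ≤ (T₀ : ℝ) / (K : ℝ)

/-- The grid points `p₀ = 0, p₁, p₂, …`: each is the largest candidate with respect to the
preceding one, or `1` if there is none. -/
def adaptivePoint (T₀ K : ℕ) (B : Multiset ℝ) : ℕ → ℝ
  | 0 => 0
  | k + 1 =>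
    if h : (candidates T₀ K B (adaptivePoint T₀ K B k)).Nonempty then
      (candidates T₀ K B (adaptivePoint T₀ K B k)).max' h
    else 1

/-- The uniform grid `{0, 1/K, …, 1}`. -/
def uniformGrid (K : ℕ) : Finset ℝ := (Finset.range (K + 1)).image fun i : ℕ => (i : ℝ) / (K : ℝ)

/-- The grid of the sellers' prices. -/
def sellerGrid (K : ℕ) : Finset ℝ := uniformGrid K

/-- The grid of the buyers' prices: `p₀ = 0`, the adaptive points `p₁, …, p_K` and the uniform
grid. -/
def buyerGrid (T₀ K : ℕ) (B : Multiset ℝ) : Finset ℝ :=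
  (Finset.range (K + 1)).image (adaptivePoint T₀ K B) ∪ uniformGrid K

/-- The output of the grid estimation for global budget balance on the sampled profiles `x`: the
two factors of the product grid (sellers' prices, buyers' prices). -/
def gridEstimationGBB {n : ℕ} (T₀ K : ℕ) (x : Fin T₀ → Valuations n) : Finset ℝ × Finset ℝ :=
  (sellerGrid K, buyerGrid T₀ K (observed x))

/-- The smallest element of the finite set `G` that is at least `x`. -/
def roundUp (G : Finset ℝ) (x : ℝ) : ℝ := sInf {y : ℝ | y ∈ G ∧ x ≤ y}

theorem roundUp_isLeast (G : Finset ℝ) (x : ℝ) (h : ∃ y ∈ G, x ≤ y) :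
    IsLeast {y : ℝ | y ∈ G ∧ x ≤ y} (roundUp G x) := by
  have hfin : ({y : ℝ | y ∈ G ∧ x ≤ y}).Finite := G.finite_toSet.subset fun y hy => hy.1
  obtain ⟨y, hy, hxy⟩ := h
  exact ⟨Set.Nonempty.csInf_mem ⟨y, hy, hxy⟩ hfin, fun z hz => csInf_le hfin.bddBelow hz⟩

/-- `ζ`: minus the revenue of the pair `(p, q)` rounded up to the product grid `G.1 × G.2`. -/
def zeta {n : ℕ} [NeZero n] (P : Measure (Valuations n)) (G : Finset ℝ × Finset ℝ) (p q : ℝ) :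
    ℝ :=
  -Rev P (roundUp G.1 p) (roundUp G.2 q)

end

end TwoSidedMarket

/-! Let `p'`, `q'` be the rounded prices, so `p ≤ p' ≤ p + 1/K` and `q ≤ q'`. The bounds hold for
every sample. If `p ≤ q'`, each trade earns at least `p - p'`. If `q' < p`, a trade lost by raising
`q` has second-highest ≤ highest < `q'` < `p`, so it earned less than nothing; only the seller's
price costs, namely `p' - p` per trade, plus trades with sellers in `(p, p']`. Under independence,
revenue factors into a buyers' part and an acceptance probability, so new sellers only rescale it
(`neg_rev_le_sub_of_isIndependent`). Under a density, they have mass at most `M (p' - p)`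
(`neg_rev_le_of_density`). -/

open MeasureTheory ProbabilityTheory

namespace TwoSidedMarket

/-! ### Order statistics of the bids. -/

section Order

variable {n : ℕ}

theorem le_highest (b : Fin n → ℝ) (i : Fin n) : b i ≤ highest b :=
  le_ciSup (Set.finite_range b).bddAbove i

theorem le_winner [NeZero n] (b : Fin n → ℝ) (i : Fin n) : b i ≤ b (winner b) :=
  (Finite.exists_max b).choose_spec i

/-- The second-highest valuation as a lattice polynomial, independent of any tie-breaking. -/
theorem secondHighest_eq_iSup_min [NeZero n] (b : Fin n → ℝ) :
    secondHighest b = ⨆ x : {x : Fin n × Fin n // x.1 ≠ x.2}, min (b x.1.1) (b x.1.2) := by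
  have hb : BddAbove (Set.range fun i : {i // i ≠ winner b} => b i) :=
    (Set.finite_range _).bddAbove
  have hb' : BddAbove
      (Set.range fun x : {x : Fin n × Fin n // x.1 ≠ x.2} => min (b x.1.1) (b x.1.2)) :=
    (Set.finite_range _).bddAbove
  unfold secondHighest
  -- With one buyer both suprema are empty, hence `0`.
  rcases isEmpty_or_nonempty {i // i ≠ winner b} with h | ⟨⟨j, hj⟩⟩
  · have : IsEmpty {x : Fin n × Fin n // x.1 ≠ x.2} := by
      refine ⟨fun x => x.2 ?_⟩
      have key : ∀ i, i = winner b := fun i => by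
        by_contra hi
        exact h.elim ⟨i, hi⟩
      rw [key x.1.1, key x.1.2]
    rw [Real.iSup_of_isEmpty, Real.iSup_of_isEmpty]
  · have : Nonempty {i // i ≠ winner b} := ⟨⟨j, hj⟩⟩
    have : Nonempty {x : Fin n × Fin n // x.1 ≠ x.2} := ⟨⟨(j, winner b), hj⟩⟩
    apply le_antisymm
    · refine ciSup_le fun i => ?_
      have h := le_ciSup hb' ⟨(i.1, winner b), i.2⟩
      simpa [min_eq_left (le_winner b i.1)] using h
    · refine ciSup_le fun x => ?_
      by_cases hx : x.1.1 = winner b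
      · have hy : x.1.2 ≠ winner b := fun h => x.2 (hx.trans h.symm)
        exact (min_le_right _ _).trans (le_ciSup hb ⟨x.1.2, hy⟩)
      · exact (min_le_left _ _).trans (le_ciSup hb ⟨x.1.1, hx⟩)

theorem secondHighest_nonneg [NeZero n] {b : Fin n → ℝ} (hb : ∀ i, 0 ≤ b i) :
    0 ≤ secondHighest b :=
  Real.iSup_nonneg fun i => hb i

theorem secondHighest_le_highest [NeZero n] {b : Fin n → ℝ} (hb : ∀ i, 0 ≤ b i) :
    secondHighest b ≤ highest b :=
  Real.iSup_le (fun i => le_highest b i) ((hb 0).trans (le_highest b 0))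

theorem secondHighest_le_one [NeZero n] {b : Fin n → ℝ} (hb : ∀ i, b i ≤ 1) :
    secondHighest b ≤ 1 :=
  Real.iSup_le (fun i => hb i) zero_le_one

theorem measurable_highest : Measurable (highest : (Fin n → ℝ) → ℝ) :=
  Measurable.iSup fun i => measurable_pi_apply i

/-- `winner` is picked by choice; the tie-free formula is a finite supremum of measurable functions.
-/
theorem measurable_secondHighest [NeZero n] :
    Measurable (secondHighest : (Fin n → ℝ) → ℝ) := by
  have h : (secondHighest : (Fin n → ℝ) → ℝ) = fun b =>
      ⨆ x : {x : Fin n × Fin n // x.1 ≠ x.2}, min (b x.1.1) (b x.1.2) :=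
    funext secondHighest_eq_iSup_min
  rw [h]
  exact Measurable.iSup fun x => (measurable_pi_apply _).min (measurable_pi_apply _)

theorem measurableSet_tradeSet (p q : ℝ) : MeasurableSet (tradeSet p q : Set (Valuations n)) :=
  (measurableSet_le measurable_snd measurable_const).inter
    (measurableSet_le measurable_const (measurable_highest.comp measurable_fst))

end Order

/-! ### Rounding up to a grid. -/

section Rounding

theorem one_mem_uniformGrid {K : ℕ} (hK : 1 ≤ K) : (1 : ℝ) ∈ uniformGrid K := by
  have hK' : (K : ℝ) ≠ 0 := by positivity
  exact Finset.mem_image.2 ⟨K, by simp, div_self hK'⟩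

theorem le_roundUp {G : Finset ℝ} {x : ℝ} (hG : 1 ∈ G) (hx : x ≤ 1) : x ≤ roundUp G x :=
  (roundUp_isLeast G x ⟨1, hG, hx⟩).1.2

theorem roundUp_eq_self {G : Finset ℝ} {x : ℝ} (hx : x ∈ G) : roundUp G x = x :=
  have h := roundUp_isLeast G x ⟨x, hx, le_rfl⟩
  le_antisymm (h.2 ⟨hx, le_rfl⟩) h.1.2

theorem roundUp_uniformGrid_le {K : ℕ} (hK : 1 ≤ K) {x : ℝ} (hx : x ∈ Set.Icc (0 : ℝ) 1) :
    roundUp (uniformGrid K) x ≤ x + 1 / K := by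
  have hK' : (0 : ℝ) < K := by positivity
  have hmem : ((⌈x * K⌉₊ : ℕ) : ℝ) / K ∈ uniformGrid K := by
    refine Finset.mem_image.2 ⟨_, Finset.mem_range.2 (Nat.lt_succ_of_le (Nat.ceil_le.2 ?_)), rfl⟩
    nlinarith [hx.2]
  have hle : x ≤ ((⌈x * K⌉₊ : ℕ) : ℝ) / K := (le_div_iff₀ hK').2 (Nat.le_ceil _)
  refine ((roundUp_isLeast _ x ⟨_, hmem, hle⟩).2 ⟨hmem, hle⟩).trans ?_
  rw [div_le_iff₀ hK', add_mul, one_div_mul_cancel hK'.ne']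
  exact (Nat.ceil_lt_add_one (mul_nonneg hx.1 hK'.le)).le

end Rounding

/-! ### Revenue loss without structure on the distribution. -/

section Revenue

variable {n : ℕ} [NeZero n] {P : Measure (Valuations n)}

theorem abs_max_sub_le {b : Fin n → ℝ} (hb : ∀ i, b i ∈ Set.Icc (0 : ℝ) 1) (p q : ℝ) :
    |max q (secondHighest b) - p| ≤ 1 + |q| + |p| := by
  have h0 := secondHighest_nonneg fun i => (hb i).1
  have h1 := secondHighest_le_one fun i => (hb i).2
  have hm : max q (secondHighest b) ≤ 1 + |q| :=
    max_le (by linarith [le_abs_self q]) (by linarith [abs_nonneg q])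
  have hm' : 0 ≤ max q (secondHighest b) := h0.trans (le_max_right _ _)
  rw [abs_le]
  constructor <;> linarith [le_abs_self p, neg_abs_le p, abs_nonneg q]

theorem integrable_revenue [IsFiniteMeasure P] (hP : SupportedOnCube P) (p q : ℝ) :
    Integrable ((tradeSet p q).indicator fun v => max q (secondHighest v.1) - p) P := by
  refine Integrable.indicator ?_ (measurableSet_tradeSet p q)
  refine Integrable.of_bound (C := 1 + |q| + |p|) ?_ ?_
  · exact ((measurable_const.max (measurable_secondHighest.comp measurable_fst)).sub_const
      p).aestronglyMeasurable
  · filter_upwards [hP] with v hv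
    exact abs_max_sub_le hv.1 p q

/-- If the reserve price is at least `p`, then raising the seller's price from `p` to `p'` loses
at most `p' - p`. -/
theorem neg_rev_le_sub [IsProbabilityMeasure P] (hP : SupportedOnCube P) {p p' q' : ℝ}
    (hp : p ≤ p') (hq : p ≤ q') : -Rev P p' q' ≤ p' - p := by
  rw [Rev, ← integral_neg]
  calc ∫ v, -(tradeSet p' q').indicator (fun v => max q' (secondHighest v.1) - p') v ∂P
      ≤ ∫ _, (p' - p) ∂P := by
        refine integral_mono (integrable_revenue hP p' q').neg (integrable_const _) fun v => ?_
        by_cases hv : v ∈ tradeSet p' q'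
        · simp only [Set.indicator_of_mem hv]
          linarith [le_max_left q' (secondHighest v.1)]
        · simp only [Set.indicator_of_notMem hv]
          linarith
    _ = p' - p := by simp

/-- Trades that are lost when the reserve price rises from `q` to some `q' < p` have negative
revenue, so the loss in revenue comes only from the rise of the seller's price. -/
theorem neg_rev_le_add_measure [IsProbabilityMeasure P] (hP : SupportedOnCube P) {p p' q q' : ℝ}
    (hp : p ≤ p') (hp₁ : p ≤ 1) (hq : q ≤ q') (hqp : q' < p) :
    -Rev P p' q' ≤ (p' - p) + P.real {v | v.2 ∈ Set.Ioc p p'} - Rev P p q := by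
  set A : Set (Valuations n) := {v | v.2 ∈ Set.Ioc p p'} with hA
  have hAm : MeasurableSet A := measurable_snd measurableSet_Ioc
  have hint : Integrable (fun v => (p' - p) + A.indicator (fun _ => (1 : ℝ)) v) P :=
    (integrable_const _).add ((integrable_const _).indicator hAm)
  have hval : ∫ v, ((p' - p) + A.indicator (fun _ => (1 : ℝ)) v) ∂P = (p' - p) + P.real A := by
    rw [integral_add (integrable_const _) ((integrable_const _).indicator hAm),
      integral_indicator_const _ hAm]
    simp
  rw [← hval, Rev, Rev, ← integral_neg, ← integral_sub hint (integrable_revenue hP p q)]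
  refine integral_mono_ae (integrable_revenue hP p' q').neg
    (hint.sub (integrable_revenue hP p q)) ?_
  filter_upwards [hP] with v hv
  have h0 := secondHighest_nonneg fun i => (hv.1 i).1
  have h1 := secondHighest_le_highest fun i => (hv.1 i).1
  have hm : max q (secondHighest v.1) ≤ max q' (secondHighest v.1) := max_le_max_right _ hq
  have hm0 : 0 ≤ max q' (secondHighest v.1) := h0.trans (le_max_right _ _)
  have hA0 : 0 ≤ A.indicator (fun _ => (1 : ℝ)) v :=
    Set.indicator_nonneg (fun _ _ => zero_le_one) v
  by_cases hv' : v ∈ tradeSet p' q'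
  · by_cases hs : v.2 ≤ p
    · have hvt : v ∈ tradeSet p q := ⟨hs, hq.trans hv'.2⟩
      simp only [Set.indicator_of_mem hv', Set.indicator_of_mem hvt]
      linarith
    -- A newly admitted seller costs at most `p' = (p' - p) + p`, and `p ≤ 1` is covered by the
    -- indicator.
    · have hvt : v ∉ tradeSet p q := fun h => hs h.1
      have hvA : v ∈ A := ⟨not_le.1 hs, hv'.1⟩
      simp only [Set.indicator_of_mem hv', Set.indicator_of_notMem hvt, Set.indicator_of_mem hvA]
      linarith
  · simp only [Set.indicator_of_notMem hv']
    by_cases hvt : v ∈ tradeSet p q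
    · have hb : highest v.1 < q' := not_le.1 fun h => hv' ⟨hvt.1.trans hp, h⟩
      have hmp : max q (secondHighest v.1) ≤ p := max_le (hq.trans hqp.le) (by linarith)
      simp only [Set.indicator_of_mem hvt]
      linarith
    · simp only [Set.indicator_of_notMem hvt]
      linarith

end Revenue

/-! ### Independent buyers and seller. -/

section Independent

variable {n : ℕ} [NeZero n]

/-- The expected revenue over the buyers' valuations, given that the seller accepts. -/
noncomputable def buyerRev (PB : Measure (Fin n → ℝ)) (p q : ℝ) : ℝ :=
  ∫ b, {b | q ≤ highest b}.indicator (fun b => max q (secondHighest b) - p) b ∂PB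

theorem rev_prod (PB : Measure (Fin n → ℝ)) (PS : Measure ℝ) [IsProbabilityMeasure PB]
    [IsProbabilityMeasure PS] (p q : ℝ) :
    Rev (PB.prod PS) p q = buyerRev PB p q * PS.real (Set.Iic p) := by
  have hS : ∫ s, (Set.Iic p).indicator (fun _ => (1 : ℝ)) s ∂PS = PS.real (Set.Iic p) := by
    rw [integral_indicator_const _ measurableSet_Iic]
    simp
  rw [← hS, buyerRev, ← integral_prod_mul, Rev]
  refine integral_congr_ae (Filter.Eventually.of_forall fun v => ?_)
  by_cases hs : v.2 ≤ p <;> by_cases hb : q ≤ highest v.1 <;>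
    simp [Set.indicator, tradeSet, hs, hb]

theorem ae_mem_cube_of_prod {m : ℕ} {PB : Measure (Fin m → ℝ)} {PS : Measure ℝ}
    [IsProbabilityMeasure PB] [IsProbabilityMeasure PS] (hP : SupportedOnCube (PB.prod PS)) :
    ∀ᵐ b ∂PB, ∀ i, b i ∈ Set.Icc (0 : ℝ) 1 := by
  filter_upwards [Measure.ae_ae_of_ae_prod hP] with b hb
  exact hb.exists.choose_spec.1

theorem integrable_buyerRev {PB : Measure (Fin n → ℝ)} [IsProbabilityMeasure PB]
    (hB : ∀ᵐ b ∂PB, ∀ i, b i ∈ Set.Icc (0 : ℝ) 1) (p q : ℝ) :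
    Integrable ({b | q ≤ highest b}.indicator fun b => max q (secondHighest b) - p) PB := by
  refine Integrable.indicator ?_ (measurableSet_le measurable_const measurable_highest)
  refine Integrable.of_bound (C := 1 + |q| + |p|) ?_ ?_
  · exact ((measurable_const.max measurable_secondHighest).sub_const p).aestronglyMeasurable
  · filter_upwards [hB] with b hb
    exact abs_max_sub_le hb p q

/-- The seller's acceptance is factored out, so no new trades appear and the bound has no measure
term. -/
theorem neg_buyerRev_le {PB : Measure (Fin n → ℝ)} [IsProbabilityMeasure PB]
    (hB : ∀ᵐ b ∂PB, ∀ i, b i ∈ Set.Icc (0 : ℝ) 1) {p p' q q' : ℝ}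
    (hp : p ≤ p') (hq : q ≤ q') (hqp : q' < p) :
    -buyerRev PB p' q' ≤ (p' - p) - buyerRev PB p q := by
  have hval : ∫ _, (p' - p) ∂PB = p' - p := by simp
  rw [← hval, buyerRev, buyerRev, ← integral_neg,
    ← integral_sub (integrable_const _) (integrable_buyerRev hB p q)]
  refine integral_mono_ae (integrable_buyerRev hB p' q').neg
    ((integrable_const _).sub (integrable_buyerRev hB p q)) ?_
  filter_upwards [hB] with b hb
  have h1 := secondHighest_le_highest fun i => (hb i).1
  have hm : max q (secondHighest b) ≤ max q' (secondHighest b) := max_le_max_right _ hq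
  by_cases hb' : q' ≤ highest b
  · simp only [Set.indicator, Set.mem_ofPred_eq, hb', hq.trans hb', if_true]
    linarith
  · by_cases hbt : q ≤ highest b
    · have hmp : max q (secondHighest b) ≤ p :=
        max_le (hq.trans hqp.le) (by linarith [not_le.1 hb'])
      simp only [Set.indicator, Set.mem_ofPred_eq, hb', hbt, if_true, if_false]
      linarith
    · simp only [Set.indicator, Set.mem_ofPred_eq, hb', hbt, if_false]
      linarith

/-- With independent buyers and seller, rounding the prices up loses at most the rise of the
seller's price. -/
theorem neg_rev_le_sub_of_isIndependent {P : Measure (Valuations n)} [IsProbabilityMeasure P]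
    (hP : SupportedOnCube P) (hind : IsIndependent P) {p p' q q' : ℝ} (hp : p ≤ p')
    (hq : q ≤ q') (hrev : 0 ≤ Rev P p q) (hpos : 0 < P {v | v.2 ≤ p} ∨ p' = p) :
    -Rev P p' q' ≤ p' - p := by
  rcases le_or_gt p q' with hpq | hqp
  · exact neg_rev_le_sub hP hp hpq
  obtain ⟨PB, PS, hPB, hPS, rfl⟩ := hind
  have hle := neg_buyerRev_le (ae_mem_cube_of_prod hP) hp hq hqp
  rw [rev_prod] at hrev ⊢
  have hS0 : 0 ≤ PS.real (Set.Iic p') := measureReal_nonneg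
  have hS1 : PS.real (Set.Iic p') ≤ 1 := measureReal_le_one
  -- Positive mass makes the buyers' factor nonnegative at `(p, q)`; multiplying by a probability
  -- then keeps the bound `p' - p ≥ 0`.
  have hmain : 0 < PS.real (Set.Iic p) →
      -(buyerRev PB p' q' * PS.real (Set.Iic p')) ≤ p' - p := fun h => by
    have hB : 0 ≤ buyerRev PB p q := nonneg_of_mul_nonneg_left hrev h
    nlinarith
  rcases hpos with h | rfl
  · refine hmain (ENNReal.toReal_pos ?_ (measure_ne_top _ _))
    have hset : {v : Valuations n | v.2 ≤ p} = Set.univ ×ˢ Set.Iic p := by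
      ext v
      simp
    rw [hset, Measure.prod_prod, measure_univ, one_mul] at h
    exact h.ne'
  -- If the seller's price does not move, zero mass means zero revenue.
  · rcases measureReal_nonneg.eq_or_lt (a := (0 : ℝ)) (b := PS.real (Set.Iic p')) with h | h
    · simp [← h]
    · exact hmain h

end Independent

/-! ### Bounded density. -/

section Density

variable {n : ℕ} {P : Measure (Valuations n)} {M : ℝ}

/-- The buyers' cube has volume one, so only the seller's coordinate contributes. -/
theorem measure_le_of_density (hP : SupportedOnCube P) (hM : HasDensityBoundedBy P M) {S : Set ℝ}
    (hS : MeasurableSet S) :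
    P {v | v.2 ∈ S} ≤ ENNReal.ofReal M * volume (S ∩ Set.Icc 0 1) := by
  obtain ⟨f, -, rfl, hfM⟩ := hM
  have hmeas : MeasurableSet ((Set.Icc 0 1 : Set (Fin n → ℝ)) ×ˢ (S ∩ Set.Icc (0 : ℝ) 1)) :=
    measurableSet_Icc.prod (hS.inter measurableSet_Icc)
  have hle : {v : Valuations n | v.2 ∈ S} ≤ᵐ[volume.withDensity f]
      (Set.Icc 0 1 : Set (Fin n → ℝ)) ×ˢ (S ∩ Set.Icc (0 : ℝ) 1) := by
    filter_upwards [hP] with v hv hvS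
    exact ⟨⟨fun i => (hv.1 i).1, fun i => (hv.1 i).2⟩, hvS, hv.2⟩
  refine (measure_mono_ae hle).trans ?_
  rw [withDensity_apply _ hmeas]
  calc _ ≤ ∫⁻ _ in (Set.Icc 0 1 : Set (Fin n → ℝ)) ×ˢ (S ∩ Set.Icc (0 : ℝ) 1),
          ENNReal.ofReal M := lintegral_mono_ae (ae_restrict_of_ae hfM)
    _ = ENNReal.ofReal M * volume (S ∩ Set.Icc 0 1) := by
        rw [setLIntegral_const, Measure.volume_eq_prod, Measure.prod_prod, Real.volume_Icc_pi]
        simp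

theorem one_le_of_density [IsProbabilityMeasure P] (hP : SupportedOnCube P)
    (hM : HasDensityBoundedBy P M) : 1 ≤ M := by
  have h := measure_le_of_density hP hM MeasurableSet.univ
  simpa using h

theorem measureReal_Ioc_le_of_density [IsProbabilityMeasure P] (hP : SupportedOnCube P)
    (hM : HasDensityBoundedBy P M) {p p' : ℝ} (hp : p ≤ p') :
    P.real {v | v.2 ∈ Set.Ioc p p'} ≤ M * (p' - p) := by
  have hM0 : 0 ≤ M := zero_le_one.trans (one_le_of_density hP hM)
  refine ENNReal.toReal_le_of_le_ofReal (mul_nonneg hM0 (sub_nonneg.2 hp)) ?_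
  refine (measure_le_of_density hP hM measurableSet_Ioc).trans ?_
  rw [ENNReal.ofReal_mul hM0, ← Real.volume_Ioc]
  gcongr
  exact Set.inter_subset_left

/-- The loss is at most `(1 + M)(p' - p)`, and `1 ≤ M` because a probability measure lives on a cube
of volume one. -/
theorem neg_rev_le_of_density [NeZero n] [IsProbabilityMeasure P] (hP : SupportedOnCube P)
    (hM : HasDensityBoundedBy P M) {p p' q q' : ℝ} (hp : p ≤ p') (hp₁ : p ≤ 1) (hq : q ≤ q')
    (hrev : 0 ≤ Rev P p q) : -Rev P p' q' ≤ 2 * M * (p' - p) := by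
  have hM1 := one_le_of_density hP hM
  rcases le_or_gt p q' with hpq | hqp
  · nlinarith [neg_rev_le_sub hP hp hpq]
  · nlinarith [neg_rev_le_add_measure hP hp hp₁ hq hqp, measureReal_Ioc_le_of_density hP hM hp]

end Density

end TwoSidedMarket

theorem mainTheorem6 {n : ℕ} [NeZero n]
    (P : Measure (TwoSidedMarket.Valuations n)) [IsProbabilityMeasure P]
    (hP : TwoSidedMarket.SupportedOnCube P)
    (T₀ K : ℕ) (hT₀ : 1 ≤ T₀) (hK : 1 ≤ K) (δ : ℝ) (hδ₀ : 0 < δ) (hδ₁ : δ < 1)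
    {Ω : Type*} [MeasurableSpace Ω] (μ : Measure Ω) [IsProbabilityMeasure μ]
    (X : Fin T₀ → Ω → TwoSidedMarket.Valuations n)
    (hX_indep : iIndepFun X μ) (hX_law : ∀ t, HasLaw (X t) P μ)
    (pstar qstar : ℝ) (hopt : TwoSidedMarket.IsOptimalPair P pstar qstar) :
    (TwoSidedMarket.IsIndependent P →
      (0 < P {v | v.2 ≤ pstar} ∨ pstar ∈ TwoSidedMarket.sellerGrid K) →
      1 - δ ≤ μ.real {ω | TwoSidedMarket.zeta P
          (TwoSidedMarket.gridEstimationGBB T₀ K fun t => X t ω) pstar qstar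
        ≤ 2 / (K : ℝ) + 2 * Real.sqrt (Real.log (2 / δ) / (2 * (T₀ : ℝ)))}) ∧
    (∀ M : ℝ, TwoSidedMarket.HasDensityBoundedBy P M →
      1 - δ ≤ μ.real {ω | TwoSidedMarket.zeta P
          (TwoSidedMarket.gridEstimationGBB T₀ K fun t => X t ω) pstar qstar
        ≤ 2 * M / (K : ℝ)}) := by
  -- Both bounds hold for every sample: if the rounded reserve price is below `pstar`, the trades
  -- lost by rounding have negative revenue, so no estimate of their probability is needed.
  have hK' : (0 : ℝ) < K := by positivity
  have hp := TwoSidedMarket.le_roundUp (TwoSidedMarket.one_mem_uniformGrid hK) hopt.seller_mem.2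
  have hpK := TwoSidedMarket.roundUp_uniformGrid_le hK hopt.seller_mem
  have hq : ∀ ω, qstar ≤ TwoSidedMarket.roundUp (TwoSidedMarket.buyerGrid T₀ K
      (TwoSidedMarket.observed fun t => X t ω)) qstar := fun ω =>
    TwoSidedMarket.le_roundUp
      (Finset.mem_union_right _ (TwoSidedMarket.one_mem_uniformGrid hK)) hopt.buyer_mem.2
  have hsure : ∀ S : Set Ω, (∀ ω, ω ∈ S) → 1 - δ ≤ μ.real S := fun S hS => by
    rw [Set.eq_univ_of_forall hS, probReal_univ]
    linarith
  refine ⟨fun hind hpos => hsure _ fun ω => ?_, fun M hM => hsure _ fun ω => ?_⟩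
  · have h := TwoSidedMarket.neg_rev_le_sub_of_isIndependent hP hind hp (hq ω) hopt.rev_nonneg
      (hpos.imp_right TwoSidedMarket.roundUp_eq_self)
    have hsq := Real.sqrt_nonneg (Real.log (2 / δ) / (2 * (T₀ : ℝ)))
    have h12 : 1 / (K : ℝ) ≤ 2 / K := by gcongr; norm_num
    exact h.trans (by linarith)
  · have h := TwoSidedMarket.neg_rev_le_of_density hP hM hp hopt.seller_mem.2 (hq ω)
      hopt.rev_nonneg
    have hM1 := TwoSidedMarket.one_le_of_density hP hM
    refine h.trans ?_
    rw [div_eq_mul_one_div (2 * M)]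
    gcongr
    linarith
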